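/- Let $T(x) = 1 - |2x-1|$ for $0 \le x \le 1$ (the tent map), and let $h : [-1/2, 1] \to [-1/2, 1]$ be defined by $h(x) = -x$ for $-1/2 \le x \le 0$ and $h(x) = T(x)$ for $0 \le x \le 1$. Then $h$ is chaotic on $[-1/2,1]$ but not topologically transitive. Here a map $f$ from a metric space $(X,d)$ to itself is called chaotic if $X$ is infinite and compact, $f$ is continuous, and there is $\delta > 0$ such that for every point $x \in X$ and every nonempty open set $V \subseteq X$ (not necessarily containing $x$) there is a point $y \in V$ with $\limsup_{n\to\infty} d(f^n(x), f^n(y)) \ge \delta$ and $\liminf_{n\to\infty} d(f^n(x), f^n(y)) = 0$. It is called topologically transitive if for all nonempty open sets $U, V \subseteq X$ there is an integer $n \ge 0$ with $f^n(U) \cap V \ne \emptyset$. The interval $[-1/2,1]$ carries the metric $d(x,y) = |x-y|$. -/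

import Mathlib

open Filter

/-- A self-map `f` of a metric space `X` is chaotic: `X` is infinite and compact, `f` is continuous,
and there is `δ > 0` such that for every point `x` and every nonempty open set `V` (which need not
contain `x`) there is `y ∈ V` with `limsup d(fⁿ x, fⁿ y) ≥ δ` and `liminf d(fⁿ x, fⁿ y) = 0`.
By compactness the sequence of distances is bounded, so the real `limsup` and `liminf` are the
usual ones. -/
def IsChaotic {X : Type*} [MetricSpace X] (f : X → X) : Prop :=
  Infinite X ∧ CompactSpace X ∧ Continuous f ∧
    ∃ δ : ℝ, 0 < δ ∧ ∀ (x : X) (V : Set X), IsOpen V → V.Nonempty →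
      ∃ y ∈ V,
        δ ≤ limsup (fun n : ℕ => dist (f^[n] x) (f^[n] y)) atTop ∧
        liminf (fun n : ℕ => dist (f^[n] x) (f^[n] y)) atTop = 0

/-- A self-map `f` of a topological space is topologically transitive: for all nonempty open
`U` and `V` some iterate `fⁿ(U)`, `n ≥ 0`, meets `V`. -/
def IsTopologicallyTransitiveMap {X : Type*} [TopologicalSpace X] (f : X → X) : Prop :=
  ∀ U V : Set X, IsOpen U → U.Nonempty → IsOpen V → V.Nonempty →
    ∃ n : ℕ, (f^[n] '' U ∩ V).Nonempty

/-- The formula of the tent map, `T x = 1 - |2x - 1|`; it is used for `0 ≤ x ≤ 1` only. -/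
noncomputable def tent (x : ℝ) : ℝ := 1 - |2 * x - 1|

/-- The formula of the map `h`: `-x` for `x ≤ 0`, and `T x` for `0 ≤ x`
(both formulas give `0` at `x = 0`). -/
noncomputable def hFormula (x : ℝ) : ℝ := if x ≤ 0 then -x else tent x

theorem hFormula_mem (x : ℝ) (hx : x ∈ Set.Icc (-1 / 2 : ℝ) 1) :
    hFormula x ∈ Set.Icc (-1 / 2 : ℝ) 1 := by
  obtain ⟨h1, h2⟩ := hx
  unfold hFormula tent
  split_ifs with h
  · constructor <;> linarith
  · have h3 : |2 * x - 1| ≤ 1 := abs_le.2 ⟨by linarith, by linarith⟩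
    have h4 := abs_nonneg (2 * x - 1)
    constructor <;> linarith

/-- The map `h` from `[-1/2, 1]` to itself. -/
noncomputable def hMap (x : Set.Icc (-1 / 2 : ℝ) 1) : Set.Icc (-1 / 2 : ℝ) 1 :=
  ⟨hFormula x, hFormula_mem x x.2⟩

/-! Doubling the argument of the triangular wave `W` of period 2 applies the tent map to its value,
so every iterate after the first step is `W (2 ^ n * u)` with `u = max x (2 * x)`. A partner of `u`
is `u + c * L`, where `L = ∑ 2 ^ (-i!)` and `c` is 1 or 1/2. The gaps between factorials make `2 ^ n
* c * L` nearly an even integer at `n = k! + 2` (proximality) and nearly `c` modulo 2 at `n = (k +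
1)!` (separation, for a suitable `c`). Adding `2 * m / 2 ^ k` to the partner affects only finitely
many iterates and moves it into any given interval. Transitivity fails because nonnegative points
never become negative. -/

open Topology LiouvilleNumber

/-! ### The triangular wave -/

/-- The distance from `t` to the nearest even integer: the triangular wave of period `2`. -/
noncomputable def triangleWave (t : ℝ) : ℝ := ‖(t : AddCircle (2 : ℝ))‖

namespace triangleWave

theorem add_two_mul_int (t : ℝ) (m : ℤ) : triangleWave (t + 2 * m) = triangleWave t := by
  have h : ((2 * m : ℝ) : AddCircle (2 : ℝ)) = 0 := by
    rw [AddCircle.coe_eq_zero_iff]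
    exact ⟨m, by simp [mul_comm]⟩
  unfold triangleWave
  rw [AddCircle.coe_add, h, add_zero]

theorem neg (t : ℝ) : triangleWave (-t) = triangleWave t := by
  unfold triangleWave
  rw [AddCircle.coe_neg, norm_neg]

theorem eq_abs {t : ℝ} (h : |t| ≤ 1) : triangleWave t = |t| :=
  (AddCircle.norm_coe_eq_abs_iff (2 : ℝ) two_ne_zero).2 (by simpa using h)

theorem le_one (t : ℝ) : triangleWave t ≤ 1 := by
  simpa [triangleWave] using
    AddCircle.norm_le_half_period (2 : ℝ) (x := (t : AddCircle (2 : ℝ))) two_ne_zero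

theorem nonneg (t : ℝ) : 0 ≤ triangleWave t := norm_nonneg _

theorem exists_eq_add_two_mul_int (t : ℝ) : ∃ (r : ℝ) (m : ℤ), |r| ≤ 1 ∧ t = r + 2 * m := by
  refine ⟨t - 2 * round (t / 2), round (t / 2), ?_, by ring⟩
  have h := abs_sub_round (t / 2)
  rw [abs_le] at h ⊢
  constructor <;> linarith [h.1, h.2]

theorem le_abs_self (t : ℝ) : triangleWave t ≤ |t| := by
  by_cases h : |t| ≤ 1
  · exact (eq_abs h).le
  · exact (le_one t).trans (not_le.1 h).le

theorem abs_sub_le (s t : ℝ) : |triangleWave s - triangleWave t| ≤ |s - t| := by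
  refine (abs_norm_sub_norm_le _ _).trans ?_
  rw [← AddCircle.coe_sub]
  exact le_abs_self (s - t)

theorem two_mul (t : ℝ) : triangleWave (2 * t) = tent (triangleWave t) := by
  have key : ∀ r : ℝ, 0 ≤ r → r ≤ 1 → triangleWave (2 * r) = tent (triangleWave r) := by
    intro r h0 h1
    rw [eq_abs (abs_le.2 ⟨by linarith, h1⟩), abs_of_nonneg h0, tent]
    rcases le_total (2 * r) 1 with h | h
    · rw [eq_abs (abs_le.2 ⟨by linarith, h⟩), abs_of_nonneg (by linarith),
        abs_of_nonpos (by linarith)]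
      ring
    · have h2 := add_two_mul_int (2 * r - 2) 1
      rw [eq_abs (t := 2 * r - 2) (abs_le.2 ⟨by linarith, by linarith⟩),
        abs_of_nonpos (by linarith)] at h2
      rw [abs_of_nonneg (by linarith)]
      push_cast at h2
      rw [show 2 * r - 2 + 2 * 1 = 2 * r by ring] at h2
      linarith
  obtain ⟨r, m, hr, rfl⟩ := exists_eq_add_two_mul_int t
  have e : 2 * (r + 2 * (m : ℝ)) = 2 * r + 2 * ((2 * m : ℤ) : ℝ) := by push_cast; ring
  rw [e, add_two_mul_int, add_two_mul_int]
  rw [abs_le] at hr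
  rcases le_total 0 r with h | h
  · exact key r h hr.2
  · have := key (-r) (by linarith) (by linarith)
    rwa [mul_neg, neg, neg] at this

/-- A shift by `1` or by `1 / 2` changes the triangular wave by at least `1 / 4`. -/
theorem shift_one_or_half (t : ℝ) :
    1 / 4 ≤ |triangleWave t - triangleWave (t + 1)| ∨
      1 / 4 ≤ |triangleWave t - triangleWave (t + 1 / 2)| := by
  obtain ⟨r, m, hr, rfl⟩ := exists_eq_add_two_mul_int t
  rw [show r + 2 * (m : ℝ) + 1 = r + 1 + 2 * m by ring,
    show r + 2 * (m : ℝ) + 1 / 2 = r + 1 / 2 + 2 * m by ring,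
    add_two_mul_int, add_two_mul_int, add_two_mul_int, eq_abs hr]
  rw [abs_le] at hr
  rcases le_total 0 r with h | h
  · have h1 := add_two_mul_int (r - 1) 1
    rw [show r - 1 + 2 * ((1 : ℤ) : ℝ) = r + 1 by push_cast; ring,
      eq_abs (t := r - 1) (abs_le.2 ⟨by linarith, by linarith⟩),
      abs_of_nonpos (by linarith)] at h1
    rw [h1, abs_of_nonneg h]
    -- The wave at `r + 1` is `1 - r`, so a shift by 1 moves the value by `|2 * r - 1|`, too little
    -- only for `r` between 3/8 and 5/8. There a shift by 1/2 lands within 1/8 of the peak.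
    rcases le_total r (3 / 8) with h2 | h2
    · left
      rw [le_abs]; right; linarith
    rcases le_total r (5 / 8) with h3 | h3
    · right
      rcases le_total r (1 / 2) with h4 | h4
      · rw [eq_abs (abs_le.2 ⟨by linarith, by linarith⟩),
          abs_of_nonneg (a := r + 1 / 2) (by linarith), le_abs]
        right; linarith
      · have h5 := add_two_mul_int (r - 3 / 2) 1
        rw [show r - 3 / 2 + 2 * ((1 : ℤ) : ℝ) = r + 1 / 2 by push_cast; ring,
          eq_abs (t := r - 3 / 2) (abs_le.2 ⟨by linarith, by linarith⟩),
          abs_of_nonpos (by linarith)] at h5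
        rw [h5, le_abs]
        right; linarith
    · left
      rw [le_abs]; left; linarith
  · rw [eq_abs (abs_le.2 ⟨by linarith, by linarith⟩), eq_abs (abs_le.2 ⟨by linarith, by linarith⟩),
      abs_of_nonpos h, abs_of_nonneg (a := r + 1) (by linarith)]
    rcases le_total r (-5 / 8) with h2 | h2
    · left
      rw [le_abs]; left; linarith
    rcases le_total r (-3 / 8) with h3 | h3
    · right
      have : |r + 1 / 2| ≤ 1 / 8 := abs_le.2 ⟨by linarith, by linarith⟩
      rw [le_abs]; left; linarith
    · left
      rw [le_abs]; right; linarith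

end triangleWave

/-! ### Lacunarity of Liouville's number -/

/-- The denominator divides `2 ^ k!`. The spare factor 4 keeps the product even after multiplication
by `c = 1 / 2`. -/
theorem exists_two_pow_mul_partialSum_eq {k N : ℕ} (h : k.factorial + 2 ≤ N) :
    ∃ m : ℕ, (2 : ℝ) ^ N * partialSum 2 k = 4 * m := by
  obtain ⟨p, hp⟩ := partialSum_eq_rat (m := 2) two_pos k
  obtain ⟨d, rfl⟩ := Nat.exists_eq_add_of_le h
  refine ⟨2 ^ d * p, ?_⟩
  push_cast at hp ⊢
  rw [hp, pow_add, pow_add]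
  field_simp
  ring

theorem two_pow_mul_remainder_lt {k : ℕ} (hk : 2 ≤ k) :
    (2 : ℝ) ^ (k.factorial + 2) * remainder 2 k < 4 * (1 / 2) ^ k := by
  have h1 := remainder_lt k (le_refl (2 : ℝ))
  have h2 : k.factorial + k ≤ k.factorial * k := by
    have := Nat.self_le_factorial k
    nlinarith
  have h3 : (2 : ℝ) ^ (k.factorial + k) ≤ (2 ^ k.factorial) ^ k := by
    rw [← pow_mul]
    exact pow_le_pow_right₀ one_le_two h2
  calc (2 : ℝ) ^ (k.factorial + 2) * remainder 2 k
      < 2 ^ (k.factorial + 2) * (1 / (2 ^ k.factorial) ^ k) := by gcongr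
    _ ≤ 2 ^ (k.factorial + 2) * (1 / 2 ^ (k.factorial + k)) := by gcongr
    _ = 4 * (1 / 2) ^ k := by
      rw [pow_add, pow_add, one_div_pow]
      field_simp
      norm_num

theorem tendsto_four_mul_half_pow : Tendsto (fun k : ℕ => 4 * (1 / 2 : ℝ) ^ k) atTop (𝓝 0) := by
  simpa using (tendsto_pow_atTop_nhds_zero_of_lt_one (r := (1 / 2 : ℝ)) (by norm_num)
    (by norm_num)).const_mul 4

/-- Along the exponents `k! + 2`, a small multiple of Liouville's number is shifted to nearly
an even integer. -/
theorem frequently_triangleWave_close (u : ℝ) {c : ℝ} (hc : c = 1 ∨ c = 1 / 2) {ε : ℝ}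
    (hε : 0 < ε) :
    ∃ᶠ n : ℕ in atTop, |triangleWave (2 ^ n * u) -
      triangleWave (2 ^ n * (u + c * liouvilleNumber 2))| < ε := by
  rw [frequently_atTop]
  intro N
  obtain ⟨k, hk, hkN, hk2⟩ := ((tendsto_four_mul_half_pow.eventually_lt_const hε).and
    ((eventually_ge_atTop N).and (eventually_ge_atTop 2))).exists
  refine ⟨k.factorial + 2, by have := Nat.self_le_factorial k; omega, ?_⟩
  obtain ⟨m, hm⟩ := exists_two_pow_mul_partialSum_eq (le_refl (k.factorial + 2))
  have hr := two_pow_mul_remainder_lt hk2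
  have hr0 : 0 < (2 : ℝ) ^ (k.factorial + 2) * remainder 2 k :=
    mul_pos (by positivity) (remainder_pos one_lt_two k)
  obtain ⟨j, hj⟩ : ∃ j : ℤ, c * (4 * m) = 2 * j := by
    rcases hc with rfl | rfl
    · exact ⟨2 * m, by push_cast; ring⟩
    · exact ⟨m, by push_cast; ring⟩
  have hsplit : (2 : ℝ) ^ (k.factorial + 2) * (u + c * liouvilleNumber 2) =
      2 ^ (k.factorial + 2) * u + c * (2 ^ (k.factorial + 2) * remainder 2 k) + 2 * j := by
    rw [← partialSum_add_remainder one_lt_two k, ← hj, ← hm]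
    ring
  rw [hsplit, triangleWave.add_two_mul_int]
  refine (triangleWave.abs_sub_le _ _).trans_lt ?_
  have hc0 : 0 < c ∧ c ≤ 1 := by rcases hc with rfl | rfl <;> norm_num
  rw [abs_lt]
  constructor <;> nlinarith

/-- Along the exponents `k!`, Liouville's number is shifted to nearly an odd integer. -/
theorem eventually_triangleWave_shift_close (u : ℝ) {c : ℝ} (hc : c = 1 ∨ c = 1 / 2) {ε : ℝ}
    (hε : 0 < ε) :
    ∀ᶠ k : ℕ in atTop, |triangleWave (2 ^ (k + 1).factorial * u + c) -
      triangleWave (2 ^ (k + 1).factorial * (u + c * liouvilleNumber 2))| < ε := by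
  have hlim := (tendsto_add_atTop_iff_nat 1).2 tendsto_four_mul_half_pow
  filter_upwards [hlim.eventually_lt_const hε, eventually_ge_atTop 2] with k hk hk2
  have hfac : k.factorial + 2 ≤ (k + 1).factorial := by
    have := Nat.self_le_factorial k
    rw [Nat.factorial_succ]
    nlinarith
  obtain ⟨m, hm⟩ := exists_two_pow_mul_partialSum_eq hfac
  have hr := two_pow_mul_remainder_lt (k := k + 1) (by omega)
  have hr0 : 0 < (2 : ℝ) ^ (k + 1).factorial * remainder 2 (k + 1) :=
    mul_pos (by positivity) (remainder_pos one_lt_two _)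
  rw [pow_add] at hr
  obtain ⟨j, hj⟩ : ∃ j : ℤ, c * (4 * m) = 2 * j := by
    rcases hc with rfl | rfl
    · exact ⟨2 * m, by push_cast; ring⟩
    · exact ⟨m, by push_cast; ring⟩
  -- The last term of the partial sum, `1 / 2 ^ (k + 1)!`, contributes exactly the shift `c`.
  have hsplit : (2 : ℝ) ^ (k + 1).factorial * (u + c * liouvilleNumber 2) =
      2 ^ (k + 1).factorial * u + c + c * (2 ^ (k + 1).factorial * remainder 2 (k + 1)) +
        2 * j := by
    rw [← partialSum_add_remainder one_lt_two (k + 1), ← hj, ← hm, partialSum_succ]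
    field_simp
    ring
  rw [hsplit, triangleWave.add_two_mul_int]
  refine (triangleWave.abs_sub_le _ _).trans_lt ?_
  have hc0 : 0 < c ∧ c ≤ 1 := by rcases hc with rfl | rfl <;> norm_num
  rw [abs_lt]
  constructor <;> nlinarith

/-- Every real `u` has a partner `v` that is proximal to it, but not asymptotic to it,
under the doubling of arguments of the triangular wave. -/
theorem exists_triangleWave_scrambled (u : ℝ) :
    ∃ v : ℝ, (∃ᶠ n : ℕ in atTop, 1 / 8 ≤ |triangleWave (2 ^ n * u) - triangleWave (2 ^ n * v)|) ∧
      ∀ ε > 0, ∃ᶠ n : ℕ in atTop,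
        |triangleWave (2 ^ n * u) - triangleWave (2 ^ n * v)| < ε := by
  have hfreq : ∃ᶠ k : ℕ in atTop,
      1 / 4 ≤ |triangleWave (2 ^ (k + 1).factorial * u) -
        triangleWave (2 ^ (k + 1).factorial * u + 1)| ∨
      1 / 4 ≤ |triangleWave (2 ^ (k + 1).factorial * u) -
        triangleWave (2 ^ (k + 1).factorial * u + 1 / 2)| :=
    (Eventually.of_forall fun k => triangleWave.shift_one_or_half _).frequently
  have hfac : Tendsto (fun k : ℕ => (k + 1).factorial) atTop atTop :=
    tendsto_atTop_mono (fun k => (Nat.le_succ k).trans (Nat.self_le_factorial _)) tendsto_id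
  have main : ∀ c : ℝ, c = 1 ∨ c = 1 / 2 →
      (∃ᶠ k : ℕ in atTop, 1 / 4 ≤ |triangleWave (2 ^ (k + 1).factorial * u) -
        triangleWave (2 ^ (k + 1).factorial * u + c)|) →
      ∃ᶠ n : ℕ in atTop, 1 / 8 ≤ |triangleWave (2 ^ n * u) -
        triangleWave (2 ^ n * (u + c * liouvilleNumber 2))| := by
    intro c hc h
    refine hfac.frequently ((h.and_eventually (eventually_triangleWave_shift_close u hc
      (show (0 : ℝ) < 1 / 8 by norm_num))).mono ?_)
    rintro k ⟨h1, h2⟩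
    have := abs_sub_le (triangleWave (2 ^ (k + 1).factorial * u))
      (triangleWave (2 ^ (k + 1).factorial * (u + c * liouvilleNumber 2)))
      (triangleWave (2 ^ (k + 1).factorial * u + c))
    rw [abs_sub_comm (triangleWave (2 ^ (k + 1).factorial * (u + c * liouvilleNumber 2)))] at this
    linarith
  -- Pigeonhole: one of the two shifts separates for infinitely many `k`.
  rcases frequently_or_distrib.1 hfreq with h | h
  · exact ⟨_, main 1 (.inl rfl) h, fun ε => frequently_triangleWave_close u (.inl rfl)⟩
  · exact ⟨_, main (1 / 2) (.inr rfl) h, fun ε => frequently_triangleWave_close u (.inr rfl)⟩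

/-! ### Iterates of `h` through the wave -/

theorem hFormula_triangleWave (t : ℝ) : hFormula (triangleWave t) = triangleWave (2 * t) := by
  rw [triangleWave.two_mul, hFormula]
  split_ifs with h
  · rw [le_antisymm h (triangleWave.nonneg t), tent]
    norm_num
  · rfl

/-- The maximum is `x` on the reflected branch and `2 * x` on the tent branch, which merges both
into one formula. -/
theorem hFormula_eq_triangleWave {x : ℝ} (hx : x ∈ Set.Icc (-1 / 2 : ℝ) 1) :
    hFormula x = triangleWave (max x (2 * x)) := by
  obtain ⟨h1, h2⟩ := hx
  rcases le_or_gt x 0 with h | h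
  · rw [max_eq_left (by linarith), triangleWave.eq_abs (abs_le.2 ⟨by linarith, h2⟩),
      abs_of_nonpos h, hFormula, if_pos h]
  · rw [max_eq_right (by linarith), triangleWave.two_mul,
      triangleWave.eq_abs (abs_le.2 ⟨by linarith, h2⟩), abs_of_pos h, hFormula, if_neg h.not_ge]

theorem coe_hMap_iterate_succ (x : Set.Icc (-1 / 2 : ℝ) 1) (n : ℕ) :
    (hMap^[n + 1] x : ℝ) = triangleWave (2 ^ n * max (x : ℝ) (2 * x)) := by
  induction n with
  | zero => simpa using! hFormula_eq_triangleWave x.2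
  | succ n ih =>
    rw [Function.iterate_succ_apply']
    change hFormula (hMap^[n + 1] x) = _
    rw [ih, hFormula_triangleWave, pow_succ']
    ring_nf

theorem continuous_hMap : Continuous hMap := by
  refine Continuous.subtype_mk ?_ _
  have h : (fun x : Set.Icc (-1 / 2 : ℝ) 1 => hFormula x) =
      fun x : Set.Icc (-1 / 2 : ℝ) 1 => triangleWave (max (x : ℝ) (2 * x)) :=
    funext fun x => hFormula_eq_triangleWave x.2
  have hw : Continuous triangleWave :=
    continuous_norm.comp (AddCircle.continuous_mk' (2 : ℝ))
  rw [h]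
  fun_prop

/-! ### Chaos and failure of transitivity -/

/-- Dilated translates of the even integers are eventually dense. -/
theorem exists_two_pow_mul_mem_Ioo {a b : ℝ} (hab : a < b) :
    ∃ k : ℕ, ∀ v : ℝ, ∃ w ∈ Set.Ioo a b, ∃ m : ℤ, 2 ^ k * w = v + 2 * m := by
  -- The dilated interval is longer than the period 2. This `k` must not depend on `v`, since the
  -- scrambled partner is chosen after `k`.
  obtain ⟨k, hk⟩ := pow_unbounded_of_one_lt (2 / (b - a)) (one_lt_two (α := ℝ))
  rw [div_lt_iff₀ (sub_pos.2 hab)] at hk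
  have hpos : (0 : ℝ) < 2 ^ k := by positivity
  refine ⟨k, fun v => ?_⟩
  have h1 := Int.lt_floor_add_one ((2 ^ k * a - v) / 2)
  have h2 := Int.floor_le ((2 ^ k * a - v) / 2)
  set m := ⌊(2 ^ k * a - v) / 2⌋
  refine ⟨(v + 2 * ((m + 1 : ℤ) : ℝ)) / 2 ^ k, ⟨?_, ?_⟩, m + 1, by field_simp⟩
  · rw [lt_div_iff₀ hpos]
    push_cast
    linarith
  · rw [div_lt_iff₀ hpos]
    push_cast
    linarith

theorem exists_Ioo_forall_mem {a b : ℝ} (hab : a < b) {V : Set (Set.Icc a b)} (hV : IsOpen V)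
    (hne : V.Nonempty) :
    ∃ c d : ℝ, c < d ∧ ∀ y, c < y → y < d → ∃ h : y ∈ Set.Icc a b, (⟨y, h⟩ : Set.Icc a b) ∈ V := by
  obtain ⟨p, hp⟩ := hne
  obtain ⟨ε, hε, hball⟩ := Metric.isOpen_iff.1 hV p hp
  obtain ⟨hp1, hp2⟩ := p.2
  refine ⟨max (p - ε) a, min (p + ε) b, ?_, fun y h1 h2 => ?_⟩
  · rw [max_lt_iff, lt_min_iff, lt_min_iff]
    refine ⟨⟨?_, ?_⟩, ?_, hab⟩ <;> linarith
  · rw [max_lt_iff] at h1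
    rw [lt_min_iff] at h2
    refine ⟨⟨h1.2.le, h2.2.le⟩, hball ?_⟩
    rw [Metric.mem_ball, Subtype.dist_eq, Real.dist_eq, abs_lt]
    constructor <;> linarith [h1.1, h2.1]

theorem hMap_isChaotic : IsChaotic hMap := by
  refine ⟨Set.infinite_coe_iff.2 (Set.Icc_infinite (by norm_num)), inferInstance,
    continuous_hMap, 1 / 8, by norm_num, fun x V hV hne => ?_⟩
  obtain ⟨a, b, hab, hsub⟩ := exists_Ioo_forall_mem (by norm_num) hV hne
  have hmax : max a (2 * a) < max b (2 * b) := max_lt_max hab (by linarith)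
  obtain ⟨k, hk⟩ := exists_two_pow_mul_mem_Ioo hmax
  obtain ⟨v, hfar, hclose⟩ := exists_triangleWave_scrambled (2 ^ k * max (x : ℝ) (2 * x))
  obtain ⟨w, ⟨haw, hwb⟩, m, hm⟩ := hk v
  -- The increasing map `max y (2 * y)` is inverted: `y` is `w` or `w / 2` according to sign.
  have hy : ∃ y, a < y ∧ y < b ∧ max y (2 * y) = w := by
    rw [max_lt_iff] at haw
    rw [lt_max_iff] at hwb
    rcases le_total w 0 with h | h
    · exact ⟨w, haw.1, by rcases hwb with h' | h' <;> linarith, max_eq_left (by linarith)⟩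
    · refine ⟨w / 2, by linarith [haw.2], by rcases hwb with h' | h' <;> linarith, ?_⟩
      rw [max_eq_right (by linarith)]
      ring
  obtain ⟨y, hay, hyb, hyw⟩ := hy
  obtain ⟨hyI, hyV⟩ := hsub y hay hyb
  have hdist : ∀ n : ℕ, dist (hMap^[n + (k + 1)] x) (hMap^[n + (k + 1)] ⟨y, hyI⟩) =
      |triangleWave (2 ^ n * (2 ^ k * max (x : ℝ) (2 * x))) - triangleWave (2 ^ n * v)| := by
    intro n
    have e : 2 ^ (n + k) * w = 2 ^ n * v + 2 * ((2 ^ n * m : ℤ) : ℝ) := by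
      rw [pow_add, mul_assoc, hm]
      push_cast
      ring
    rw [Subtype.dist_eq, Real.dist_eq, ← add_assoc, coe_hMap_iterate_succ, coe_hMap_iterate_succ,
      hyw, e, triangleWave.add_two_mul_int, pow_add, mul_assoc]
  refine ⟨_, hyV, ?_⟩
  rw [← limsup_nat_add _ (k + 1), ← liminf_nat_add _ (k + 1)]
  simp only [hdist]
  have hbdd : IsBoundedUnder (· ≤ ·) atTop fun n : ℕ =>
      |triangleWave (2 ^ n * (2 ^ k * max (x : ℝ) (2 * x))) - triangleWave (2 ^ n * v)| := by
    refine isBoundedUnder_of ⟨1, fun n => abs_le.2 ⟨?_, ?_⟩⟩ <;>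
    linarith [triangleWave.nonneg (2 ^ n * (2 ^ k * max (x : ℝ) (2 * x))),
      triangleWave.le_one (2 ^ n * (2 ^ k * max (x : ℝ) (2 * x))),
      triangleWave.nonneg (2 ^ n * v), triangleWave.le_one (2 ^ n * v)]
  have hbdd' : IsBoundedUnder (· ≥ ·) atTop fun n : ℕ =>
      |triangleWave (2 ^ n * (2 ^ k * max (x : ℝ) (2 * x))) - triangleWave (2 ^ n * v)| :=
    isBoundedUnder_of ⟨0, fun n => abs_nonneg _⟩
  refine ⟨le_limsup_of_frequently_le hfar hbdd, le_antisymm ?_ ?_⟩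
  · refine le_of_forall_pos_le_add fun ε hε => ?_
    rw [zero_add]
    exact liminf_le_of_frequently_le ((hclose ε hε).mono fun n hn => hn.le) hbdd'
  · exact le_liminf_of_le hbdd.isCoboundedUnder_ge (Eventually.of_forall fun n => abs_nonneg _)

theorem not_isTopologicallyTransitiveMap_hMap : ¬ IsTopologicallyTransitiveMap hMap := by
  intro h
  obtain ⟨n, -, ⟨x, hx, rfl⟩, hneg⟩ := h {x | 0 < (x : ℝ)} {x | (x : ℝ) < 0}
    (isOpen_lt continuous_const continuous_subtype_val) ⟨⟨1, by norm_num⟩, by simp⟩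
    (isOpen_lt continuous_subtype_val continuous_const)
    ⟨⟨-1 / 2, by norm_num⟩, by norm_num [Set.mem_ofPred_eq]⟩
  cases n with
  | zero => exact lt_asymm (show 0 < (x : ℝ) from hx) hneg
  | succ n =>
    rw [Set.mem_ofPred_eq, coe_hMap_iterate_succ] at hneg
    exact (triangleWave.nonneg _).not_gt hneg

theorem theorem5 : IsChaotic hMap ∧ ¬ IsTopologicallyTransitiveMap hMap :=
  ⟨hMap_isChaotic, not_isTopologicallyTransitiveMap_hMap⟩
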